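/- **Setting.** Let $H_1\in\mathbb C^{n_1\times m}$, $H_2\in\mathbb C^{n_2\times m}$, $W_k=H_k^+H_k$ ($k=1,2$), where $^+$ is the Hermitian conjugate. For a covariance $R\ge 0$ (an $m\times m$ positive semidefinite matrix) let $C(R)=\log|I+W_1R|$ (natural logarithm of the determinant). Consider the capacity $C=\max_R C(R)$ subject to $R\ge 0$, the total power constraint (TPC) $\mathrm{tr}(R)\le P_T$ and the interference power constraint (IPC) $\mathrm{tr}(W_2R)\le P_I$. A maximizer $R^*$ is called an optimal covariance. A constraint is *redundant* if omitting it does not change the supremum of $C(R)$, and *active* if it is not redundant and holds with equality at the optimum. *Dual variables* of the TPC and the IPC at $R$ are $\mu_1,\mu_2\ge 0$ that satisfy, together with feasible $R$ and some $M\ge 0$ with $MR=0$, the KKT conditions $-(I+W_1R)^{-1}W_1-M+\mu_1I+\mu_2W_2=0$, $\mu_1(\mathrm{tr}(R)-P_T)=0$, $\mu_2(\mathrm{tr}(W_2R)-P_I)=0$. Let $\lambda_1(\cdot)$ be the largest eigenvalue of a Hermitian matrix and $(\cdot)_+$ its positive part (negative eigenvalues replaced by $0$). **Proposition.** Let $W_1$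 be of full rank $m$ and let $W_2=\lambda_2u_2u_2^+$ be of rank one, with $\lambda_2>0$ and $u_2^+u_2=1$. Let $$P_{I,th}=m^{-1}\lambda_2\bigl(P_T+\mathrm{tr}(W_1^{-1})\bigr)-\lambda_2u_2^+W_1^{-1}u_2 .$$ 1. If $P_I\ge P_{I,th}$ and $P_T>m\lambda_1(W_1^{-1})-\mathrm{tr}(W_1^{-1})$, then the IPC is redundant, and the optimal covariance is unique, is of full rank and is the standard water-filling solution $$R^*=(\mu_{WF}^{-1}I-W_1^{-1})_+=\mu_{WF}^{-1}I-W_1^{-1},\qquad \mu_{WF}^{-1}=m^{-1}\bigl(P_T+\mathrm{tr}(W_1^{-1})\bigr),$$ with $\mu_{WF}>0$ and $\mathrm{tr}(R^*)=P_T$; $\mu_1=\mu_{WF}$, $\mu_2=0$ are dual variables at $R^*$. 2. Let $m\ge 2$. If $$\lambda_2\lambda_1(W_1^{-1})-\lambda_2u_2^+W_1^{-1}u_2<P_I<P_{I,th},\qquad P_T>m\lambda_2^{-1}P_I+m\,u_2^+W_1^{-1}u_2-\mathrm{tr}(W_1^{-1}),$$ then the IPC and the TPC are active, and the optimal covariance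 is unique, is of full rank and is given by $$R^*=\mu_1^{-1}I-W_1^{-1}-\alpha u_2u_2^+,\qquad \alpha=\mu_1^{-1}-(\mu_1+\lambda_2\mu_2)^{-1},$$ where $\mu_1,\mu_2>0$ are the (unique) dual variables at $R^*$, namely $$\mu_1=\bigl(P_T-\lambda_2^{-1}P_I-u_2^+W_1^{-1}u_2+\mathrm{tr}(W_1^{-1})\bigr)^{-1}(m-1),\qquad \mu_2=\bigl(P_I+\lambda_2u_2^+W_1^{-1}u_2\bigr)^{-1}-\lambda_2^{-1}\mu_1 .$$ -/

import Mathlib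

open scoped ComplexOrder Matrix

noncomputable section

namespace MIMO

/-- The Gram matrix `W = H⁺ H` of a channel matrix `H` with `n` receive and `m` transmit
antennas. -/
def gram {n m : ℕ} (H : Matrix (Fin n) (Fin m) ℂ) : Matrix (Fin m) (Fin m) ℂ :=
  Hᴴ * H

/-- The rate `C(R) = log |I + W₁ R|` (in nats) of Gaussian signalling with covariance `R`.
For a Gram matrix `W₁` and a covariance `R ≥ 0` the determinant is a positive real number, see
`det_one_add_gram_mul_pos`, so taking its real part is harmless. -/
def rate {m : ℕ} (W₁ R : Matrix (Fin m) (Fin m) ℂ) : ℝ :=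
  Real.log (1 + W₁ * R).det.re

theorem det_one_add_gram_mul_pos {n m : ℕ} (H : Matrix (Fin n) (Fin m) ℂ)
    (R : Matrix (Fin m) (Fin m) ℂ) (hR : R.PosSemidef) :
    0 < (1 + gram H * R).det := by
  have h : (1 + gram H * R).det = (1 + H * R * Hᴴ).det := by
    rw [gram, Matrix.mul_assoc, Matrix.det_one_add_mul_comm]
  rw [h]
  exact (Matrix.PosDef.one.add_posSemidef (hR.mul_mul_conjTranspose_same H)).det_pos

/-- Covariances that satisfy the total power constraint (TPC) `tr R ≤ P_T`. -/
def tpcSet (m : ℕ) (PT : ℝ) : Set (Matrix (Fin m) (Fin m) ℂ) :=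
  {R | R.PosSemidef ∧ R.trace.re ≤ PT}

/-- Covariances that satisfy the interference power constraint (IPC) `tr (W₂ R) ≤ P_I`. -/
def ipcSet {m : ℕ} (W₂ : Matrix (Fin m) (Fin m) ℂ) (PI : ℝ) :
    Set (Matrix (Fin m) (Fin m) ℂ) :=
  {R | R.PosSemidef ∧ (W₂ * R).trace.re ≤ PI}

/-- The constraint set `S_R` under the joint TPC and IPC. -/
def feasibleSet {m : ℕ} (W₂ : Matrix (Fin m) (Fin m) ℂ) (PT PI : ℝ) :
    Set (Matrix (Fin m) (Fin m) ℂ) :=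
  tpcSet m PT ∩ ipcSet W₂ PI

/-- The capacity under a constraint set `S`: the supremum of the rate over `S`, as an extended
real number since it is infinite for some unbounded `S`. -/
def capacity {m : ℕ} (W₁ : Matrix (Fin m) (Fin m) ℂ) (S : Set (Matrix (Fin m) (Fin m) ℂ)) :
    EReal :=
  ⨆ R ∈ S, (rate W₁ R : EReal)

/-- `R` is an optimal (capacity-achieving) covariance over the constraint set `S`. -/
def IsOptimal {m : ℕ} (W₁ : Matrix (Fin m) (Fin m) ℂ) (S : Set (Matrix (Fin m) (Fin m) ℂ))
    (R : Matrix (Fin m) (Fin m) ℂ) : Prop :=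
  R ∈ S ∧ ∀ Q ∈ S, rate W₁ Q ≤ rate W₁ R

/-- The IPC is redundant: omitting it does not affect the capacity. -/
def IPCRedundant {m : ℕ} (W₁ W₂ : Matrix (Fin m) (Fin m) ℂ) (PT PI : ℝ) : Prop :=
  capacity W₁ (tpcSet m PT) = capacity W₁ (feasibleSet W₂ PT PI)

/-- The TPC is redundant: omitting it does not affect the capacity. -/
def TPCRedundant {m : ℕ} (W₁ W₂ : Matrix (Fin m) (Fin m) ℂ) (PT PI : ℝ) : Prop :=
  capacity W₁ (ipcSet W₂ PI) = capacity W₁ (feasibleSet W₂ PT PI)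

/-- `μ₁`, `μ₂` are Lagrange multipliers (dual variables) of the TPC and of the IPC at `R`: the
Karush-Kuhn-Tucker conditions hold, with `M` the multiplier of the constraint `R ≥ 0`. -/
def IsKKT {m : ℕ} (W₁ W₂ : Matrix (Fin m) (Fin m) ℂ) (PT PI : ℝ)
    (R : Matrix (Fin m) (Fin m) ℂ) (μ₁ μ₂ : ℝ) : Prop :=
  R ∈ feasibleSet W₂ PT PI ∧ 0 ≤ μ₁ ∧ 0 ≤ μ₂ ∧
  μ₁ * (R.trace.re - PT) = 0 ∧ μ₂ * ((W₂ * R).trace.re - PI) = 0 ∧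
  ∃ M : Matrix (Fin m) (Fin m) ℂ, M.PosSemidef ∧ M * R = 0 ∧
    -((1 + W₁ * R)⁻¹ * W₁) - M + (μ₁ : ℂ) • (1 : Matrix (Fin m) (Fin m) ℂ) + (μ₂ : ℂ) • W₂ = 0

/-- The positive part `(A)₊` of a Hermitian matrix: eigenvalues `λ` are replaced by
`max λ 0` and eigenvectors are kept. -/
def posEigenPart {m : ℕ} (A : Matrix (Fin m) (Fin m) ℂ) : Matrix (Fin m) (Fin m) ℂ :=
  cfc (fun x : ℝ => max x 0) A

/-- The water-filling covariance `(μ⁻¹ I - W₁⁻¹)₊` for an invertible `W₁`. -/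
def waterFilling {m : ℕ} (W₁ : Matrix (Fin m) (Fin m) ℂ) (μ : ℝ) : Matrix (Fin m) (Fin m) ℂ :=
  posEigenPart (((μ⁻¹ : ℝ) : ℂ) • (1 : Matrix (Fin m) (Fin m) ℂ) - W₁⁻¹)

/-- The largest eigenvalue `λ₁(A)` of a Hermitian matrix `A` of positive size. -/
def maxEigenvalue {m : ℕ} (A : Matrix (Fin m) (Fin m) ℂ) : ℝ :=
  sSup (spectrum ℝ A)

/-- The quadratic form `u⁺ A u`, real for Hermitian `A`. -/
def quadForm {m : ℕ} (A : Matrix (Fin m) (Fin m) ℂ) (u : Fin m → ℂ) : ℝ :=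
  (star u ⬝ᵥ (A *ᵥ u)).re

/-- The threshold `P_{I,th} = m⁻¹ λ₂ (P_T + tr W₁⁻¹) - λ₂ u₂⁺ W₁⁻¹ u₂`. -/
def thresholdPI {m : ℕ} (W₁ : Matrix (Fin m) (Fin m) ℂ) (lam₂ : ℝ) (u₂ : Fin m → ℂ) (PT : ℝ) :
    ℝ :=
  (m : ℝ)⁻¹ * lam₂ * (PT + (W₁⁻¹).trace.re) - lam₂ * quadForm W₁⁻¹ u₂

/-- The dual variable `μ_WF`, with `μ_WF⁻¹ = m⁻¹ (P_T + tr W₁⁻¹)`. -/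
def muWF {m : ℕ} (W₁ : Matrix (Fin m) (Fin m) ℂ) (PT : ℝ) : ℝ :=
  ((m : ℝ)⁻¹ * (PT + (W₁⁻¹).trace.re))⁻¹

/-- `μ₁ = (P_T - λ₂⁻¹ P_I - u₂⁺ W₁⁻¹ u₂ + tr W₁⁻¹)⁻¹ (m - 1)`. -/
def mu₁ {m : ℕ} (W₁ : Matrix (Fin m) (Fin m) ℂ) (lam₂ : ℝ) (u₂ : Fin m → ℂ) (PT PI : ℝ) : ℝ :=
  (PT - lam₂⁻¹ * PI - quadForm W₁⁻¹ u₂ + (W₁⁻¹).trace.re)⁻¹ * ((m : ℝ) - 1)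

/-- `μ₂ = (P_I + λ₂ u₂⁺ W₁⁻¹ u₂)⁻¹ - λ₂⁻¹ μ₁`. -/
def mu₂ {m : ℕ} (W₁ : Matrix (Fin m) (Fin m) ℂ) (lam₂ : ℝ) (u₂ : Fin m → ℂ) (PT PI : ℝ) : ℝ :=
  (PI + lam₂ * quadForm W₁⁻¹ u₂)⁻¹ - lam₂⁻¹ * mu₁ W₁ lam₂ u₂ PT PI

/-- `α = μ₁⁻¹ - (μ₁ + λ₂ μ₂)⁻¹`. -/
def alpha {m : ℕ} (W₁ : Matrix (Fin m) (Fin m) ℂ) (lam₂ : ℝ) (u₂ : Fin m → ℂ) (PT PI : ℝ) : ℝ :=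
  (mu₁ W₁ lam₂ u₂ PT PI)⁻¹ -
    (mu₁ W₁ lam₂ u₂ PT PI + lam₂ * mu₂ W₁ lam₂ u₂ PT PI)⁻¹

/-- The covariance `μ₁⁻¹ I - W₁⁻¹ - α u₂ u₂⁺`. -/
def jointCovariance {m : ℕ} (W₁ : Matrix (Fin m) (Fin m) ℂ) (lam₂ : ℝ) (u₂ : Fin m → ℂ)
    (PT PI : ℝ) : Matrix (Fin m) (Fin m) ℂ :=
  (((mu₁ W₁ lam₂ u₂ PT PI)⁻¹ : ℝ) : ℂ) • (1 : Matrix (Fin m) (Fin m) ℂ) - W₁⁻¹ -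
    (alpha W₁ lam₂ u₂ PT PI : ℂ) • Matrix.vecMulVec u₂ (star u₂)

end MIMO

end

noncomputable section

namespace MIMO

variable {m : ℕ}

/-! With `X = W₁⁻¹ + R` the rate is `log det W₁ + log det X`, and `log det` is strictly concave, so
a positive definite KKT point should be the only optimum. Concretely, `det X < det X₀` whenever `tr
(X₀⁻¹ X) ≤ m` and `X ≠ X₀` (`det_re_lt_det_re`). At a KKT point with `M = 0` the matrix `X₀⁻¹`
equals `μ₁ I + μ₂ W₂`, so the trace bound follows from feasibility and complementary slackness
(`IsKKT.rate_lt`).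

It remains to exhibit KKT points. Water-filling makes `X` scalar. When both constraints bind, `X`
has one eigenvalue `b` along `u` and another, `a`, on its complement; the IPC fixes `b`, and the TPC
then fixes `a` (`twoLevel`, `jointCovariance_isKKT`). Activity is proved by comparing unique optima
of different constraint sets. -/

theorem posDef_gram_of_rank_eq {n : ℕ} (H : Matrix (Fin n) (Fin m) ℂ)
    (h : (gram H).rank = m) : (gram H).PosDef := by
  have hs : (gram H).PosSemidef := Matrix.posSemidef_conjTranspose_mul_self H
  rw [hs.1.posDef_iff_eigenvalues_pos]
  intro i
  refine lt_of_le_of_ne (hs.eigenvalues_nonneg i) fun h0 => ?_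
  rw [hs.1.rank_eq_card_non_zero_eigs] at h
  -- A zero eigenvalue would leave fewer than `m` nonzero ones, contradicting the rank.
  have := Fintype.card_subtype_lt (p := fun i => hs.1.eigenvalues i ≠ 0) (x := i)
    (by simpa using h0.symm)
  simp only [Fintype.card_fin] at this
  omega

/-! ### Strict concavity of the log-determinant -/

/-- Apply `x ≤ exp (x - 1)` to each eigenvalue and multiply; the inequality is strict at an
eigenvalue other than `1`, which exists because `Y` is diagonalizable and not the identity. -/
theorem det_re_lt_one_of_trace_le {Y : Matrix (Fin m) (Fin m) ℂ} (hY : Y.PosDef)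
    (htr : Y.trace.re ≤ m) (hne : Y ≠ 1) : Y.det.re < 1 := by
  have hdet : Y.det.re = ∏ i, hY.1.eigenvalues i := by
    rw [hY.1.det_eq_prod_eigenvalues]
    norm_cast
  have htr' : ∑ i, (hY.1.eigenvalues i - 1) ≤ 0 := by
    have : Y.trace.re = ∑ i, hY.1.eigenvalues i := by
      rw [hY.1.trace_eq_sum_eigenvalues]
      norm_cast
    simp only [Finset.sum_sub_distrib, Finset.sum_const, Finset.card_univ, Fintype.card_fin,
      nsmul_eq_mul, mul_one]
    linarith
  obtain ⟨i, hi⟩ : ∃ i, hY.1.eigenvalues i ≠ 1 := by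
    by_contra! hall
    apply hne
    have hsp := hY.1.spectral_theorem
    have : (RCLike.ofReal ∘ hY.1.eigenvalues : Fin m → ℂ) = fun _ => 1 := by
      funext i
      simp [hall i]
    rw [this, Matrix.diagonal_one, map_one] at hsp
    exact hsp
  rw [hdet]
  calc ∏ i, hY.1.eigenvalues i < ∏ i, Real.exp (hY.1.eigenvalues i - 1) := by
        refine Finset.prod_lt_prod (fun j _ => hY.eigenvalues_pos j) (fun j _ => ?_)
          ⟨i, Finset.mem_univ i, ?_⟩
        · linarith [Real.add_one_le_exp (hY.1.eigenvalues j - 1)]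
        · linarith [Real.add_one_lt_exp (sub_ne_zero.mpr hi)]
    _ = Real.exp (∑ i, (hY.1.eigenvalues i - 1)) := (Real.exp_sum _ _).symm
    _ ≤ 1 := Real.exp_le_one_iff.mpr htr'

/-- Factoring `X₀⁻¹ = Bᴴ B` and passing to the congruent matrix `B X Bᴴ` reduces to the case `X₀ =
1`. -/
theorem det_re_lt_det_re {X₀ X : Matrix (Fin m) (Fin m) ℂ} (hX₀ : X₀.PosDef) (hX : X.PosDef)
    (htr : (X₀⁻¹ * X).trace.re ≤ m) (hne : X ≠ X₀) : X.det.re < X₀.det.re := by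
  have hdet₀ : IsUnit X₀.det := (Matrix.isUnit_iff_isUnit_det _).mp hX₀.isUnit
  obtain ⟨B, hB⟩ : ∃ B : Matrix (Fin m) (Fin m) ℂ, X₀⁻¹ = Bᴴ * B := by
    open scoped MatrixOrder in
    exact CStarAlgebra.nonneg_iff_eq_star_mul_self.mp hX₀.inv.posSemidef.nonneg
  have hBB : Bᴴ * B * X₀ = 1 := by rw [← hB, Matrix.nonsing_inv_mul _ hdet₀]
  have hB1 : B * (X₀ * Bᴴ) = 1 := by
    rw [mul_eq_one_comm, mul_assoc, mul_eq_one_comm]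
    exact hBB
  have hBu : IsUnit B := IsUnit.of_mul_eq_one _ hB1
  have hBs : IsUnit Bᴴ := hBu.star
  have hY : (B * X * Bᴴ).PosDef :=
    hX.mul_mul_conjTranspose_same (Matrix.vecMul_injective_of_isUnit hBu)
  have hYtr : (B * X * Bᴴ).trace = (X₀⁻¹ * X).trace := by
    rw [Matrix.trace_mul_comm, ← mul_assoc, hB]
  have hYne : B * X * Bᴴ ≠ 1 := by
    intro h
    apply hne
    rw [← hB1, ← mul_assoc] at h
    exact hBu.mul_left_cancel (hBs.mul_right_cancel h)
  have h1 := det_re_lt_one_of_trace_le hY (by rwa [hYtr]) hYne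
  have hdetY : X.det = (B * X * Bᴴ).det * X₀.det := by
    have := congrArg Matrix.det hBB
    simp only [Matrix.det_mul, Matrix.det_one] at this ⊢
    linear_combination (-X.det) * this
  have h0 := Complex.pos_iff.mp hX₀.det_pos
  have hre : X.det.re = (B * X * Bᴴ).det.re * X₀.det.re := by
    rw [hdetY, Complex.mul_re, ← h0.2]
    ring
  rw [hre]
  nlinarith [h0.1]

theorem one_add_mul_eq {W R : Matrix (Fin m) (Fin m) ℂ} (hW : W.PosDef) :
    1 + W * R = W * (W⁻¹ + R) := by
  rw [mul_add, Matrix.mul_nonsing_inv _ ((Matrix.isUnit_iff_isUnit_det _).mp hW.isUnit)]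

theorem rate_lt_rate {W R₀ R : Matrix (Fin m) (Fin m) ℂ} (hW : W.PosDef)
    (hR₀ : R₀.PosSemidef) (hR : R.PosSemidef)
    (htr : ((W⁻¹ + R₀)⁻¹ * R).trace.re ≤ ((W⁻¹ + R₀)⁻¹ * R₀).trace.re) (hne : R ≠ R₀) :
    rate W R < rate W R₀ := by
  have hX₀ : (W⁻¹ + R₀).PosDef := hW.inv.add_posSemidef hR₀
  have hX : (W⁻¹ + R).PosDef := hW.inv.add_posSemidef hR
  have hlt : (W⁻¹ + R).det.re < (W⁻¹ + R₀).det.re := by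
    refine det_re_lt_det_re hX₀ hX ?_ (by simpa using hne)
    have h1 : ((W⁻¹ + R₀)⁻¹ * (W⁻¹ + R₀)).trace.re = m := by
      rw [Matrix.nonsing_inv_mul _ ((Matrix.isUnit_iff_isUnit_det _).mp hX₀.isUnit)]
      simp
    rw [mul_add, Matrix.trace_add, Complex.add_re] at h1 ⊢
    linarith
  have hWd := Complex.pos_iff.mp hW.det_pos
  have hXd := Complex.pos_iff.mp hX.det_pos
  have key : ∀ Q, (1 + W * Q).det.re = W.det.re * (W⁻¹ + Q).det.re := by
    intro Q
    rw [one_add_mul_eq hW, Matrix.det_mul, Complex.mul_re, ← hWd.2]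
    ring
  rw [rate, rate, key, key]
  exact Real.log_lt_log (mul_pos hWd.1 hXd.1) (mul_lt_mul_of_pos_left hlt hWd.1)

/-! ### KKT points and optimality -/

/-- An invertible `R` forces `M = 0` through `M R = 0`, so stationarity becomes an explicit formula
for `(W₁⁻¹ + R)⁻¹`. -/
theorem isKKT_iff_of_posDef {W₁ W₂ R : Matrix (Fin m) (Fin m) ℂ} {PT PI μ₁ μ₂ : ℝ}
    (hW : W₁.PosDef) (hR : R.PosDef) :
    IsKKT W₁ W₂ PT PI R μ₁ μ₂ ↔ R ∈ feasibleSet W₂ PT PI ∧ 0 ≤ μ₁ ∧ 0 ≤ μ₂ ∧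
      μ₁ * (R.trace.re - PT) = 0 ∧ μ₂ * ((W₂ * R).trace.re - PI) = 0 ∧
      (W₁⁻¹ + R)⁻¹ = (μ₁ : ℂ) • (1 : Matrix (Fin m) (Fin m) ℂ) + (μ₂ : ℂ) • W₂ := by
  have hinv : (1 + W₁ * R)⁻¹ * W₁ = (W₁⁻¹ + R)⁻¹ := by
    rw [one_add_mul_eq hW, Matrix.mul_inv_rev, mul_assoc,
      Matrix.nonsing_inv_mul _ ((Matrix.isUnit_iff_isUnit_det _).mp hW.isUnit), mul_one]
  rw [IsKKT, hinv]
  refine and_congr_right fun _ => and_congr_right fun _ => and_congr_right fun _ =>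
    and_congr_right fun _ => and_congr_right fun _ => ⟨?_, fun h => ⟨0, .zero, zero_mul _, ?_⟩⟩
  · rintro ⟨M, -, hMR, h⟩
    have hM : M = 0 := hR.isUnit.mul_right_cancel (by rw [hMR, zero_mul])
    rw [hM, sub_zero, add_assoc, neg_add_eq_zero] at h
    exact h
  · rw [h]
    abel

/-- Pairing with `(W₁⁻¹ + R)⁻¹` is the functional `μ₁ tr S + μ₂ tr (W₂ S)`, which by complementary
slackness is maximized over the feasible set at `R`. -/
theorem IsKKT.rate_lt {W₁ W₂ R Q : Matrix (Fin m) (Fin m) ℂ} {PT PI μ₁ μ₂ : ℝ}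
    (h : IsKKT W₁ W₂ PT PI R μ₁ μ₂) (hW : W₁.PosDef) (hR : R.PosDef)
    (hQ : Q ∈ feasibleSet W₂ PT PI) (hne : Q ≠ R) : rate W₁ Q < rate W₁ R := by
  obtain ⟨-, h₁, h₂, hc₁, hc₂, hinv⟩ := (isKKT_iff_of_posDef hW hR).mp h
  obtain ⟨⟨hQ0, hQ1⟩, -, hQ2⟩ := hQ
  refine rate_lt_rate hW hR.posSemidef hQ0 ?_ hne
  have key : ∀ S : Matrix (Fin m) (Fin m) ℂ, ((W₁⁻¹ + R)⁻¹ * S).trace.re =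
      μ₁ * S.trace.re + μ₂ * (W₂ * S).trace.re := by
    intro S
    rw [hinv, add_mul, smul_mul_assoc, smul_mul_assoc, one_mul, Matrix.trace_add,
      Matrix.trace_smul, Matrix.trace_smul]
    simp
  rw [key, key]
  nlinarith [mul_le_mul_of_nonneg_left hQ1 h₁, mul_le_mul_of_nonneg_left hQ2 h₂]

theorem IsKKT.isOptimal_iff {W₁ W₂ R : Matrix (Fin m) (Fin m) ℂ} {PT PI μ₁ μ₂ : ℝ}
    (h : IsKKT W₁ W₂ PT PI R μ₁ μ₂) (hW : W₁.PosDef) (hR : R.PosDef)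
    (Q : Matrix (Fin m) (Fin m) ℂ) : IsOptimal W₁ (feasibleSet W₂ PT PI) Q ↔ Q = R := by
  constructor
  · intro hQ
    by_contra hne
    exact absurd (hQ.2 R h.1) (not_le.mpr (h.rate_lt hW hR hQ.1 hne))
  · rintro rfl
    refine ⟨h.1, fun S hS => ?_⟩
    by_cases hne : S = Q
    · rw [hne]
    · exact (h.rate_lt hW hR hS hne).le

theorem IsOptimal.capacity_eq {W₁ R : Matrix (Fin m) (Fin m) ℂ}
    {S : Set (Matrix (Fin m) (Fin m) ℂ)} (h : IsOptimal W₁ S R) :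
    capacity W₁ S = (rate W₁ R : EReal) :=
  le_antisymm (iSup₂_le fun Q hQ => EReal.coe_le_coe_iff.mpr (h.2 Q hQ))
    (le_iSup₂_of_le R h.1 le_rfl)

theorem le_capacity {W₁ R : Matrix (Fin m) (Fin m) ℂ} {S : Set (Matrix (Fin m) (Fin m) ℂ)}
    (h : R ∈ S) : (rate W₁ R : EReal) ≤ capacity W₁ S :=
  le_iSup₂_of_le R h le_rfl

/-- Lets the KKT results for joint constraints cover the problem with the TPC alone. -/
theorem feasibleSet_zero (PT : ℝ) :
    feasibleSet (0 : Matrix (Fin m) (Fin m) ℂ) PT 0 = tpcSet m PT := by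
  ext R
  simp only [feasibleSet, tpcSet, ipcSet, Set.mem_inter_iff, Set.mem_ofPred_eq, zero_mul,
    Matrix.trace_zero, Complex.zero_re, le_refl, and_true, and_iff_left_iff_imp]
  exact fun h => h.1

/-! ### Spectral bounds and the positive part -/

theorem posDef_smul_one_sub {A : Matrix (Fin m) (Fin m) ℂ} (hA : A.IsHermitian) {c : ℝ}
    (hc : maxEigenvalue A < c) :
    ((c : ℂ) • (1 : Matrix (Fin m) (Fin m) ℂ) - A).PosDef := by
  have hH : ((c : ℂ) • (1 : Matrix (Fin m) (Fin m) ℂ) - A).IsHermitian :=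
    (Matrix.isHermitian_one.smul (by simp [IsSelfAdjoint])).sub hA
  rw [hH.posDef_iff_eigenvalues_pos]
  intro i
  have hi : hH.eigenvalues i ∈ spectrum ℝ ((c : ℂ) • (1 : Matrix (Fin m) (Fin m) ℂ) - A) := by
    rw [hH.spectrum_real_eq_range_eigenvalues]
    exact ⟨i, rfl⟩
  generalize hH.eigenvalues i = y at hi ⊢
  have hc1 : (c : ℂ) • (1 : Matrix (Fin m) (Fin m) ℂ) =
      algebraMap ℝ (Matrix (Fin m) (Fin m) ℂ) c := by
    rw [Algebra.algebraMap_eq_smul_one]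
    ext i j
    simp [Matrix.smul_apply]
  rw [hc1, ← spectrum.singleton_sub_eq] at hi
  obtain ⟨x, hx, rfl⟩ : ∃ x ∈ spectrum ℝ A, c - x = y := by
    simpa [Set.mem_sub] using hi
  have hbdd : BddAbove (spectrum ℝ A) := by
    rw [hA.spectrum_real_eq_range_eigenvalues]
    exact (Set.finite_range _).bddAbove
  have : x ≤ maxEigenvalue A := le_csSup hbdd hx
  linarith

theorem maxEigenvalue_pos [NeZero m] {A : Matrix (Fin m) (Fin m) ℂ} (hA : A.PosDef) :
    0 < maxEigenvalue A := by
  have hbdd : BddAbove (spectrum ℝ A) := by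
    rw [hA.1.spectrum_real_eq_range_eigenvalues]
    exact (Set.finite_range _).bddAbove
  refine lt_of_lt_of_le (hA.eigenvalues_pos 0) (le_csSup hbdd ?_)
  rw [hA.1.spectrum_real_eq_range_eigenvalues]
  exact ⟨0, rfl⟩

theorem posEigenPart_eq_self {A : Matrix (Fin m) (Fin m) ℂ} (hA : A.PosDef) :
    posEigenPart A = A := by
  rw [posEigenPart]
  conv_rhs => rw [← cfc_id' ℝ A hA.1]
  refine cfc_congr fun x hx => ?_
  rw [hA.1.spectrum_real_eq_range_eigenvalues] at hx
  obtain ⟨i, rfl⟩ := hx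
  exact max_eq_left (hA.eigenvalues_pos i).le

/-! ### Rank-one projections and two-level covariances -/

theorem vecMulVec_star_mul_self {u : Fin m → ℂ} (hu : star u ⬝ᵥ u = 1) :
    Matrix.vecMulVec u (star u) * Matrix.vecMulVec u (star u) = Matrix.vecMulVec u (star u) := by
  rw [Matrix.vecMulVec_mul_vecMulVec, hu]
  simp

theorem trace_vecMulVec_star {u : Fin m → ℂ} (hu : star u ⬝ᵥ u = 1) :
    (Matrix.vecMulVec u (star u)).trace = 1 := by
  rw [Matrix.trace_vecMulVec, dotProduct_comm, hu]

theorem trace_vecMulVec_star_mul (u : Fin m → ℂ) (A : Matrix (Fin m) (Fin m) ℂ) :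
    (Matrix.vecMulVec u (star u) * A).trace.re = quadForm A u := by
  rw [Matrix.vecMulVec_mul, Matrix.trace_vecMulVec, dotProduct_comm, ← Matrix.dotProduct_mulVec,
    quadForm]

theorem posSemidef_one_sub_vecMulVec_star {u : Fin m → ℂ} (hu : star u ⬝ᵥ u = 1) :
    (1 - Matrix.vecMulVec u (star u)).PosSemidef := by
  have hH : (1 - Matrix.vecMulVec u (star u))ᴴ = 1 - Matrix.vecMulVec u (star u) := by
    rw [Matrix.conjTranspose_sub, Matrix.conjTranspose_one, Matrix.conjTranspose_vecMulVec,
      star_star]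
  have h := Matrix.posSemidef_conjTranspose_mul_self (1 - Matrix.vecMulVec u (star u))
  rwa [hH, mul_sub, mul_one, sub_mul, one_mul, vecMulVec_star_mul_self hu, sub_self,
    sub_zero] at h

theorem smul_one_sub_smul_vecMulVec_inv {u : Fin m → ℂ} (hu : star u ⬝ᵥ u = 1) {a b : ℂ}
    (ha : a ≠ 0) (hb : b ≠ 0) :
    (a • (1 : Matrix (Fin m) (Fin m) ℂ) - (a - b) • Matrix.vecMulVec u (star u))⁻¹ =
      a⁻¹ • (1 : Matrix (Fin m) (Fin m) ℂ) + (b⁻¹ - a⁻¹) • Matrix.vecMulVec u (star u) := by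
  refine Matrix.inv_eq_right_inv ?_
  have hUU := vecMulVec_star_mul_self hu
  generalize Matrix.vecMulVec u (star u) = U at hUU ⊢
  simp only [sub_mul, mul_add, smul_mul_assoc, mul_smul_comm, one_mul, mul_one, hUU]
  match_scalars <;> field_simp
  ring

/-- The covariance `R` for which `W₁⁻¹ + R` has the eigenvalue `b` at `u` and the eigenvalue `a`
on the orthogonal complement of `u`. -/
def twoLevel (W₁ : Matrix (Fin m) (Fin m) ℂ) (u : Fin m → ℂ) (a b : ℝ) :
    Matrix (Fin m) (Fin m) ℂ :=
  (a : ℂ) • (1 : Matrix (Fin m) (Fin m) ℂ) - W₁⁻¹ - ((a - b : ℝ) : ℂ) •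
    Matrix.vecMulVec u (star u)

/-- Split off `b I - W₁⁻¹`, positive definite by the eigenvalue bound; the rest is `a - b ≥ 0` times
the projection onto the complement of `u`. -/
theorem twoLevel_posDef {W₁ : Matrix (Fin m) (Fin m) ℂ} {u : Fin m → ℂ} {a b : ℝ}
    (hW : W₁.PosDef) (hu : star u ⬝ᵥ u = 1) (hb : maxEigenvalue W₁⁻¹ < b) (hab : b ≤ a) :
    (twoLevel W₁ u a b).PosDef := by
  have h : twoLevel W₁ u a b = ((b : ℂ) • (1 : Matrix (Fin m) (Fin m) ℂ) - W₁⁻¹) +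
      ((a - b : ℝ) : ℂ) • (1 - Matrix.vecMulVec u (star u)) := by
    rw [twoLevel]
    push_cast
    match_scalars <;> ring
  rw [h]
  exact (posDef_smul_one_sub hW.inv.1 hb).add_posSemidef
    ((posSemidef_one_sub_vecMulVec_star hu).smul (by exact_mod_cast sub_nonneg.mpr hab))

theorem twoLevel_trace {W₁ : Matrix (Fin m) (Fin m) ℂ} {u : Fin m → ℂ} {a b : ℝ}
    (hu : star u ⬝ᵥ u = 1) :
    (twoLevel W₁ u a b).trace.re = m * a - W₁⁻¹.trace.re - (a - b) := by
  rw [twoLevel, Matrix.trace_sub, Matrix.trace_sub, Matrix.trace_smul, Matrix.trace_smul,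
    trace_vecMulVec_star hu]
  simp [mul_comm]

theorem twoLevel_quadForm {W₁ : Matrix (Fin m) (Fin m) ℂ} {u : Fin m → ℂ} {a b : ℝ}
    (hu : star u ⬝ᵥ u = 1) :
    (Matrix.vecMulVec u (star u) * twoLevel W₁ u a b).trace.re = b - quadForm W₁⁻¹ u := by
  rw [twoLevel, mul_sub, mul_sub, mul_smul_comm, mul_smul_comm, mul_one,
    vecMulVec_star_mul_self hu, Matrix.trace_sub, Matrix.trace_sub, Matrix.trace_smul,
    Matrix.trace_smul, trace_vecMulVec_star hu, Complex.sub_re, Complex.sub_re,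
    trace_vecMulVec_star_mul]
  simp

theorem inv_add_twoLevel_inv {W₁ : Matrix (Fin m) (Fin m) ℂ} {u : Fin m → ℂ} {a b : ℝ}
    (hu : star u ⬝ᵥ u = 1) (ha : a ≠ 0) (hb : b ≠ 0) :
    (W₁⁻¹ + twoLevel W₁ u a b)⁻¹ = ((a⁻¹ : ℝ) : ℂ) • (1 : Matrix (Fin m) (Fin m) ℂ) +
      ((b⁻¹ - a⁻¹ : ℝ) : ℂ) • Matrix.vecMulVec u (star u) := by
  have h := smul_one_sub_smul_vecMulVec_inv hu (Complex.ofReal_ne_zero.mpr ha)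
    (Complex.ofReal_ne_zero.mpr hb)
  push_cast
  rw [← h, twoLevel]
  push_cast
  congr 1
  abel

theorem smul_re_trace (c : ℝ) (U R : Matrix (Fin m) (Fin m) ℂ) :
    (((c : ℂ) • U) * R).trace.re = c * (U * R).trace.re := by
  rw [smul_mul_assoc, Matrix.trace_smul]
  simp

theorem neZero_of_unit {u : Fin m → ℂ} (hu : star u ⬝ᵥ u = 1) : NeZero m :=
  ⟨by rintro rfl; simp [dotProduct] at hu⟩

theorem isKKT_twoLevel {W₁ : Matrix (Fin m) (Fin m) ℂ} {u : Fin m → ℂ} {a b lam PT PI : ℝ}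
    (hW : W₁.PosDef) (hu : star u ⬝ᵥ u = 1) (hlam : 0 < lam) (hb : maxEigenvalue W₁⁻¹ < b)
    (hab : b ≤ a) (hT : m * a - W₁⁻¹.trace.re - (a - b) = PT)
    (hI : lam * (b - quadForm W₁⁻¹ u) = PI) :
    IsKKT W₁ ((lam : ℂ) • Matrix.vecMulVec u (star u)) PT PI (twoLevel W₁ u a b)
      a⁻¹ (lam⁻¹ * (b⁻¹ - a⁻¹)) := by
  have := neZero_of_unit hu
  have hb0 : 0 < b := (maxEigenvalue_pos hW.inv).trans hb
  have ha0 : 0 < a := hb0.trans_le hab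
  have hR := twoLevel_posDef hW hu hb hab
  have htr : (twoLevel W₁ u a b).trace.re = PT := by rw [twoLevel_trace hu, hT]
  have hip : (((lam : ℂ) • Matrix.vecMulVec u (star u)) * twoLevel W₁ u a b).trace.re = PI := by
    rw [smul_re_trace, twoLevel_quadForm hu, hI]
  rw [isKKT_iff_of_posDef hW hR, inv_add_twoLevel_inv hu ha0.ne' hb0.ne', smul_smul, htr, hip]
  refine ⟨⟨⟨hR.posSemidef, htr.le⟩, ⟨hR.posSemidef, hip.le⟩⟩, (inv_pos.mpr ha0).le,
    mul_nonneg (inv_pos.mpr hlam).le (sub_nonneg.mpr (inv_anti₀ hb0 hab)), by simp, by simp, ?_⟩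
  have hl : (lam : ℂ) ≠ 0 := Complex.ofReal_ne_zero.mpr hlam.ne'
  push_cast
  congr 2
  field_simp

theorem isKKT_smul_one_sub [NeZero m] {W₁ W₂ : Matrix (Fin m) (Fin m) ℂ} {c PT PI : ℝ}
    (hW : W₁.PosDef) (hc : maxEigenvalue W₁⁻¹ < c)
    (hT : ((c : ℂ) • (1 : Matrix (Fin m) (Fin m) ℂ) - W₁⁻¹).trace.re = PT)
    (hI : (W₂ * ((c : ℂ) • (1 : Matrix (Fin m) (Fin m) ℂ) - W₁⁻¹)).trace.re ≤ PI) :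
    IsKKT W₁ W₂ PT PI ((c : ℂ) • (1 : Matrix (Fin m) (Fin m) ℂ) - W₁⁻¹) c⁻¹ 0 := by
  have hR := posDef_smul_one_sub hW.inv.1 hc
  have hc0 : (c : ℂ) ≠ 0 :=
    Complex.ofReal_ne_zero.mpr ((maxEigenvalue_pos hW.inv).trans hc).ne'
  rw [isKKT_iff_of_posDef hW hR]
  refine ⟨⟨⟨hR.posSemidef, hT.le⟩, ⟨hR.posSemidef, hI⟩⟩,
    (inv_pos.mpr ((maxEigenvalue_pos hW.inv).trans hc)).le, le_rfl,
    by rw [hT, sub_self, mul_zero], zero_mul _, ?_⟩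
  refine Matrix.inv_eq_right_inv ?_
  rw [add_sub_cancel, Complex.ofReal_zero, zero_smul, add_zero, smul_mul_smul_comm, mul_one,
    Complex.ofReal_inv, mul_inv_cancel₀ hc0, one_smul]

theorem trace_smul_one_sub (A : Matrix (Fin m) (Fin m) ℂ) (c : ℝ) :
    ((c : ℂ) • (1 : Matrix (Fin m) (Fin m) ℂ) - A).trace.re = m * c - A.trace.re := by
  rw [Matrix.trace_sub, Matrix.trace_smul]
  simp [mul_comm]

theorem trace_vecMulVec_mul_smul_one_sub {u : Fin m → ℂ} (hu : star u ⬝ᵥ u = 1)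
    (A : Matrix (Fin m) (Fin m) ℂ) (c lam : ℝ) :
    (((lam : ℂ) • Matrix.vecMulVec u (star u)) *
      ((c : ℂ) • (1 : Matrix (Fin m) (Fin m) ℂ) - A)).trace.re = lam * (c - quadForm A u) := by
  rw [smul_re_trace, mul_sub, mul_smul_comm, mul_one, Matrix.trace_sub, Matrix.trace_smul,
    trace_vecMulVec_star hu, Complex.sub_re, trace_vecMulVec_star_mul]
  simp

/-- Both pairs give the same `(W₁⁻¹ + R)⁻¹`. Its trace minus its quadratic form at `u` is `(m - 1)
μ₁`, which determines `μ₁` since `m ≥ 2`; the quadratic form then determines `μ₂`. -/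
theorem IsKKT.unique {W₁ R : Matrix (Fin m) (Fin m) ℂ} {u : Fin m → ℂ}
    {lam PT PI μ₁ μ₂ ν₁ ν₂ : ℝ} (hm : 2 ≤ m) (hW : W₁.PosDef) (hR : R.PosDef)
    (hu : star u ⬝ᵥ u = 1) (hlam : 0 < lam)
    (hμ : IsKKT W₁ ((lam : ℂ) • Matrix.vecMulVec u (star u)) PT PI R μ₁ μ₂)
    (hν : IsKKT W₁ ((lam : ℂ) • Matrix.vecMulVec u (star u)) PT PI R ν₁ ν₂) :
    ν₁ = μ₁ ∧ ν₂ = μ₂ := by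
  obtain ⟨-, -, -, -, -, h₁⟩ := (isKKT_iff_of_posDef hW hR).mp hμ
  obtain ⟨-, -, -, -, -, h₂⟩ := (isKKT_iff_of_posDef hW hR).mp hν
  rw [h₁] at h₂
  have htr := congrArg (fun M => M.trace.re) h₂
  have hq := congrArg (fun M => (Matrix.vecMulVec u (star u) * M).trace.re) h₂
  simp only [mul_add, mul_smul_comm, mul_one, vecMulVec_star_mul_self hu, Matrix.trace_add,
    Matrix.trace_smul, trace_vecMulVec_star hu, Matrix.trace_one, Fintype.card_fin] at htr hq
  simp at htr hq
  have hm' : (2 : ℝ) ≤ m := by exact_mod_cast hm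
  have h1 : ν₁ = μ₁ := by
    have : (ν₁ - μ₁) * ((m : ℝ) - 1) = 0 := by linear_combination hq - htr
    rcases mul_eq_zero.mp this with h | h <;> linarith
  subst h1
  exact ⟨rfl, mul_right_cancel₀ hlam.ne' (by linarith)⟩

theorem rank_eq_of_posDef {R : Matrix (Fin m) (Fin m) ℂ} (hR : R.PosDef) : R.rank = m := by
  rw [Matrix.rank_of_isUnit _ hR.isUnit, Fintype.card_fin]

/-! ### The covariance with both constraints tight -/

theorem mu₁_eq_inv (W₁ : Matrix (Fin m) (Fin m) ℂ) (lam : ℝ) (u : Fin m → ℂ) (PT PI : ℝ) :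
    mu₁ W₁ lam u PT PI =
      ((PT - lam⁻¹ * PI - quadForm W₁⁻¹ u + W₁⁻¹.trace.re) / ((m : ℝ) - 1))⁻¹ := by
  rw [mu₁, inv_div, div_eq_mul_inv, mul_comm]

theorem mu₂_eq {W₁ : Matrix (Fin m) (Fin m) ℂ} {lam : ℝ} (hlam : lam ≠ 0) (u : Fin m → ℂ)
    (PT PI : ℝ) :
    mu₂ W₁ lam u PT PI =
      lam⁻¹ * ((lam⁻¹ * PI + quadForm W₁⁻¹ u)⁻¹ - mu₁ W₁ lam u PT PI) := by
  rw [mu₂, mul_sub, ← mul_inv, mul_add, mul_inv_cancel_left₀ hlam]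

theorem jointCovariance_eq_twoLevel {W₁ : Matrix (Fin m) (Fin m) ℂ} {lam : ℝ} (hlam : lam ≠ 0)
    (u : Fin m → ℂ) (PT PI : ℝ) :
    jointCovariance W₁ lam u PT PI =
      twoLevel W₁ u ((PT - lam⁻¹ * PI - quadForm W₁⁻¹ u + W₁⁻¹.trace.re) / ((m : ℝ) - 1))
        (lam⁻¹ * PI + quadForm W₁⁻¹ u) := by
  rw [jointCovariance, alpha, twoLevel, mu₂_eq hlam, mul_inv_cancel_left₀ hlam,
    add_sub_cancel, inv_inv, mu₁_eq_inv, inv_inv]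

/-- In the regime where both constraints matter, the covariance `jointCovariance` is positive
definite and satisfies the KKT conditions with positive multipliers `mu₁`, `mu₂`. -/
theorem jointCovariance_isKKT {W₁ : Matrix (Fin m) (Fin m) ℂ} {u : Fin m → ℂ} {lam PT PI : ℝ}
    (hm : 2 ≤ m) (hW : W₁.PosDef) (hu : star u ⬝ᵥ u = 1) (hlam : 0 < lam)
    (hI : lam * maxEigenvalue W₁⁻¹ - lam * quadForm W₁⁻¹ u < PI)
    (hT : (m : ℝ) * lam⁻¹ * PI + (m : ℝ) * quadForm W₁⁻¹ u - W₁⁻¹.trace.re < PT) :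
    (jointCovariance W₁ lam u PT PI).PosDef ∧
      (jointCovariance W₁ lam u PT PI).trace.re = PT ∧
      (((lam : ℂ) • Matrix.vecMulVec u (star u)) * jointCovariance W₁ lam u PT PI).trace.re = PI ∧
      0 < mu₁ W₁ lam u PT PI ∧ 0 < mu₂ W₁ lam u PT PI ∧
      IsKKT W₁ ((lam : ℂ) • Matrix.vecMulVec u (star u)) PT PI (jointCovariance W₁ lam u PT PI)
        (mu₁ W₁ lam u PT PI) (mu₂ W₁ lam u PT PI) := by
  have := neZero_of_unit hu
  have hm1 : (0 : ℝ) < (m : ℝ) - 1 := by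
    have : (2 : ℝ) ≤ m := by exact_mod_cast hm
    linarith
  rw [jointCovariance_eq_twoLevel hlam.ne', mu₂_eq hlam.ne', mu₁_eq_inv]
  have hbI : lam * (lam⁻¹ * PI + quadForm W₁⁻¹ u - quadForm W₁⁻¹ u) = PI := by
    rw [add_sub_cancel_right, mul_inv_cancel_left₀ hlam.ne']
  have hb : maxEigenvalue W₁⁻¹ < lam⁻¹ * PI + quadForm W₁⁻¹ u := by
    refine lt_of_mul_lt_mul_left ?_ hlam.le
    linarith
  have haT : (PT - lam⁻¹ * PI - quadForm W₁⁻¹ u + W₁⁻¹.trace.re) / ((m : ℝ) - 1) *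
      ((m : ℝ) - 1) = PT - lam⁻¹ * PI - quadForm W₁⁻¹ u + W₁⁻¹.trace.re :=
    div_mul_cancel₀ _ hm1.ne'
  -- With `b` the left side, `(m - 1) a = PT - b + tr W₁⁻¹`, so `b < a` is exactly the lower bound
  -- on `PT`.
  have hab : lam⁻¹ * PI + quadForm W₁⁻¹ u <
      (PT - lam⁻¹ * PI - quadForm W₁⁻¹ u + W₁⁻¹.trace.re) / ((m : ℝ) - 1) := by
    rw [lt_div_iff₀ hm1]
    linarith
  generalize (PT - lam⁻¹ * PI - quadForm W₁⁻¹ u + W₁⁻¹.trace.re) / ((m : ℝ) - 1) = a at haT hab ⊢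
  have htr : (m : ℝ) * a - W₁⁻¹.trace.re - (a - (lam⁻¹ * PI + quadForm W₁⁻¹ u)) = PT := by
    linarith
  have hb0 := (maxEigenvalue_pos hW.inv).trans hb
  refine ⟨twoLevel_posDef hW hu hb hab.le, by rw [twoLevel_trace hu, htr],
    by rw [smul_re_trace, twoLevel_quadForm hu, hbI], inv_pos.mpr (hb0.trans hab),
    mul_pos (inv_pos.mpr hlam) (sub_pos.mpr (inv_strictAnti₀ hb0 hab)),
    isKKT_twoLevel hW hu hlam hb hab.le htr hbI⟩

end MIMO

end

theorem mainTheorem10 {n₁ n₂ m : ℕ}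
    (H₁ : Matrix (Fin n₁) (Fin m) ℂ) (H₂ : Matrix (Fin n₂) (Fin m) ℂ)
    (W₁ W₂ : Matrix (Fin m) (Fin m) ℂ)
    (hW₁ : W₁ = MIMO.gram H₁) (hW₂ : W₂ = MIMO.gram H₂)
    (hfull : W₁.rank = m)
    (lam₂ : ℝ) (u₂ : Fin m → ℂ) (hlam₂ : 0 < lam₂) (hu₂ : star u₂ ⬝ᵥ u₂ = 1)
    (hrank1 : W₂ = (lam₂ : ℂ) • Matrix.vecMulVec u₂ (star u₂))
    (PT PI : ℝ) :
    -- first regime: the IPC is redundant and full-rank water-filling is optimal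
    ((MIMO.thresholdPI W₁ lam₂ u₂ PT ≤ PI →
      (m : ℝ) * MIMO.maxEigenvalue W₁⁻¹ - (W₁⁻¹).trace.re < PT →
      ∃ Ropt : Matrix (Fin m) (Fin m) ℂ,
        (∀ R, MIMO.IsOptimal W₁ (MIMO.feasibleSet W₂ PT PI) R ↔ R = Ropt) ∧
        MIMO.IPCRedundant W₁ W₂ PT PI ∧
        Ropt.rank = m ∧
        0 < MIMO.muWF W₁ PT ∧
        Ropt = MIMO.waterFilling W₁ (MIMO.muWF W₁ PT) ∧
        Ropt.trace.re = PT ∧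
        Ropt = (((MIMO.muWF W₁ PT)⁻¹ : ℝ) : ℂ) • (1 : Matrix (Fin m) (Fin m) ℂ) - W₁⁻¹ ∧
        MIMO.IsKKT W₁ W₂ PT PI Ropt (MIMO.muWF W₁ PT) 0)) ∧
    -- second regime: both constraints are active
    (2 ≤ m →
      lam₂ * MIMO.maxEigenvalue W₁⁻¹ - lam₂ * MIMO.quadForm W₁⁻¹ u₂ < PI →
      PI < MIMO.thresholdPI W₁ lam₂ u₂ PT →
      (m : ℝ) * lam₂⁻¹ * PI + (m : ℝ) * MIMO.quadForm W₁⁻¹ u₂ - (W₁⁻¹).trace.re < PT →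
      ∃ Ropt : Matrix (Fin m) (Fin m) ℂ,
        (∀ R, MIMO.IsOptimal W₁ (MIMO.feasibleSet W₂ PT PI) R ↔ R = Ropt) ∧
        Ropt.trace.re = PT ∧ (W₂ * Ropt).trace.re = PI ∧
        ¬ MIMO.TPCRedundant W₁ W₂ PT PI ∧ ¬ MIMO.IPCRedundant W₁ W₂ PT PI ∧
        Ropt.rank = m ∧
        Ropt = MIMO.jointCovariance W₁ lam₂ u₂ PT PI ∧
        0 < MIMO.mu₁ W₁ lam₂ u₂ PT PI ∧ 0 < MIMO.mu₂ W₁ lam₂ u₂ PT PI ∧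
        (∀ ν₁ ν₂ : ℝ, MIMO.IsKKT W₁ W₂ PT PI Ropt ν₁ ν₂ ↔
          ν₁ = MIMO.mu₁ W₁ lam₂ u₂ PT PI ∧ ν₂ = MIMO.mu₂ W₁ lam₂ u₂ PT PI)) := by
  have hW : W₁.PosDef := by
    subst hW₁
    exact MIMO.posDef_gram_of_rank_eq H₁ hfull
  have := MIMO.neZero_of_unit hu₂
  have hm0 : (0 : ℝ) < m := by exact_mod_cast Nat.pos_of_neZero m
  have hc : (m : ℝ) * ((m : ℝ)⁻¹ * (PT + W₁⁻¹.trace.re)) - W₁⁻¹.trace.re = PT := by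
    rw [mul_inv_cancel_left₀ hm0.ne', add_sub_cancel_right]
  have hth : lam₂ * ((m : ℝ)⁻¹ * (PT + W₁⁻¹.trace.re) - MIMO.quadForm W₁⁻¹ u₂) =
      MIMO.thresholdPI W₁ lam₂ u₂ PT := by
    rw [MIMO.thresholdPI]
    ring
  subst hrank1
  clear hW₂
  have hWF : MIMO.muWF W₁ PT = ((m : ℝ)⁻¹ * (PT + W₁⁻¹.trace.re))⁻¹ := rfl
  rw [hWF, MIMO.waterFilling, inv_inv]
  generalize (m : ℝ)⁻¹ * (PT + W₁⁻¹.trace.re) = c at hc hth ⊢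
  have htr := (MIMO.trace_smul_one_sub W₁⁻¹ c).trans hc
  have hip := (MIMO.trace_vecMulVec_mul_smul_one_sub hu₂ W₁⁻¹ c lam₂).trans hth
  have hopt : MIMO.maxEigenvalue W₁⁻¹ < c → ∀ Q, MIMO.IsOptimal W₁ (MIMO.tpcSet m PT) Q ↔
      Q = (c : ℂ) • (1 : Matrix (Fin m) (Fin m) ℂ) - W₁⁻¹ := by
    intro hcm
    -- With `W₂ = 0` and `PI = 0` the IPC holds trivially.
    rw [← MIMO.feasibleSet_zero]
    exact (MIMO.isKKT_smul_one_sub hW hcm htr (by simp)).isOptimal_iff hW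
      (MIMO.posDef_smul_one_sub hW.inv.1 hcm)
  constructor
  · intro hPI hPT
    have hcm : MIMO.maxEigenvalue W₁⁻¹ < c := by
      refine lt_of_mul_lt_mul_left ?_ hm0.le
      linarith
    have hR := MIMO.posDef_smul_one_sub hW.inv.1 hcm
    have hK := MIMO.isKKT_smul_one_sub hW hcm htr (hip.trans_le hPI)
    refine ⟨_, hK.isOptimal_iff hW hR, ?_, MIMO.rank_eq_of_posDef hR,
      inv_pos.mpr ((MIMO.maxEigenvalue_pos hW.inv).trans hcm),
      (MIMO.posEigenPart_eq_self hR).symm, htr, rfl, hK⟩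
    rw [MIMO.IPCRedundant, ((hopt hcm _).mpr rfl).capacity_eq,
      ((hK.isOptimal_iff hW hR _).mpr rfl).capacity_eq]
  · intro hm hI hth' hT
    obtain ⟨hR, hRT, hRI, hμ₁, hμ₂, hK⟩ :=
      MIMO.jointCovariance_isKKT hm hW hu₂ hlam₂ hI hT
    have hoptR := (hK.isOptimal_iff hW hR _).mpr rfl
    refine ⟨_, hK.isOptimal_iff hW hR, hRT, hRI, ?_, ?_, MIMO.rank_eq_of_posDef hR, rfl, hμ₁,
      hμ₂, fun ν₁ ν₂ => ⟨fun hν => hK.unique hm hW hR hu₂ hlam₂ hν, ?_⟩⟩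
    · -- With a larger total power the optimum still obeys the IPC and has a larger rate.
      obtain ⟨hS, hST, -, -, -, hKS⟩ :=
        MIMO.jointCovariance_isKKT (PT := PT + 1) hm hW hu₂ hlam₂ hI (by linarith)
      rw [MIMO.TPCRedundant, hoptR.capacity_eq]
      have hlt := hKS.rate_lt hW hS (Q := MIMO.jointCovariance W₁ lam₂ u₂ PT PI)
        ⟨⟨hR.posSemidef, by linarith⟩, hK.1.2⟩ (fun h => by rw [h] at hRT; linarith)
      exact ((EReal.coe_lt_coe_iff.mpr hlt).trans_le (MIMO.le_capacity hKS.1.2)).ne'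
    · -- Without the IPC the unique optimum is water-filling, which violates the IPC.
      -- The lower and upper bounds on `PI` chain together, so water-filling has full rank here too.
      have hcm : MIMO.maxEigenvalue W₁⁻¹ < c := by
        refine lt_of_mul_lt_mul_left ?_ hlam₂.le
        linarith
      rw [MIMO.IPCRedundant, hoptR.capacity_eq, ((hopt hcm _).mpr rfl).capacity_eq]
      intro h
      have hRopt : MIMO.IsOptimal W₁ (MIMO.tpcSet m PT)
          (MIMO.jointCovariance W₁ lam₂ u₂ PT PI) :=
        ⟨hK.1.1, fun Q hQ => (((hopt hcm _).mpr rfl).2 Q hQ).trans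
          (EReal.coe_eq_coe_iff.mp h).le⟩
      rw [(hopt hcm _).mp hRopt, hip] at hRI
      exact hth'.ne' hRI
    · rintro ⟨rfl, rfl⟩
      exact hK
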